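/- Let $G$ be a finite group. A rational $G$-Mackey functor $M$ consists of a $\mathbb{Q}$-module $M(G/H)$ for each subgroup $H \leqslant G$ together with $\mathbb{Q}$-linear restriction maps $R^H_K \colon M(G/H) \to M(G/K)$ and induction maps $I^H_K \colon M(G/K) \to M(G/H)$ for $K \leqslant H \leqslant G$, and conjugation maps $C_g \colon M(G/H) \to M(G/gHg^{-1})$ for $g \in G$, such that: 1. $R^H_H = \mathrm{id} = I^H_H$ for all $H \leqslant G$, and $C_h = \mathrm{id}$ on $M(G/H)$ for $h \in H$; 2. $I^H_L = I^H_K \circ I^K_L$ and $R^H_L = R^K_L \circ R^H_K$ for $L \leqslant K \leqslant H$, and $C_{gh} = C_g \circ C_h$ for $g, h \in G$; 3. $R^{gHg^{-1}}_{gKg^{-1}} \circ C_g = C_g \circ R^H_K$ and $I^{gHg^{-1}}_{gKg^{-1}} \circ C_g = C_g \circ I^H_K$ for $K \leqslant H$ and $g \in G$; 4. $R^H_K \circ I^H_L = \sum_{x} I^K_{K \cap xLx^{-1}} \circ C_x \circ R^L_{L \cap x^{-1}Kx}$ for $K, L \leqslant H$, where $x$ runs over any system of representatives in $H$ of the double cosets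 $K \backslash H / L$. A morphism $M \to N$ is a family of $\mathbb{Q}$-linear maps $M(G/H) \to N(G/H)$, $H \leqslant G$, commuting with all restriction, induction and conjugation maps. Then every rational $G$-Mackey functor is both a projective and an injective object of the category of rational $G$-Mackey functors. -/

import Mathlib

open CategoryTheory
open scoped Pointwise

universe u v

/-- `K ∩ x L x⁻¹ = x (L ∩ x⁻¹ K x) x⁻¹`, the identification of subgroups used in the
double coset formula. Here `MulAut.conj x • L` is the subgroup `x L x⁻¹`. -/
theorem inf_conj_smul_eq {G : Type u} [Group G] (K L : Subgroup G) (x : G) :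
    K ⊓ MulAut.conj x • L = MulAut.conj x • (L ⊓ MulAut.conj x⁻¹ • K) := by
  rw [Subgroup.smul_inf, smul_smul, ← map_mul, mul_inv_cancel, map_one, one_smul, inf_comm]

/-- A rational `G`-Mackey functor. The value `M(G/H)` is `obj H`; `res`, `ind` and `conj` are the
restriction `R^H_K`, the induction `I^H_K` and the conjugation `C_g : M(G/H) → M(G/gHg⁻¹)`.
So that equal subgroups need not be syntactically equal, the target of `conj g` is any
subgroup `H'` given with a proof that `H' = g H g⁻¹`. -/
structure RationalMackeyFunctor (G : Type u) [Group G] [Finite G] where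
  /-- the `ℚ`-module `M(G/H)` -/
  obj : Subgroup G → Type v
  [addCommGroup : ∀ H, AddCommGroup (obj H)]
  [module : ∀ H, Module ℚ (obj H)]
  /-- restriction `R^H_K` for `K ≤ H` -/
  res : ∀ {K H : Subgroup G}, K ≤ H → (obj H →ₗ[ℚ] obj K)
  /-- induction `I^H_K` for `K ≤ H` -/
  ind : ∀ {K H : Subgroup G}, K ≤ H → (obj K →ₗ[ℚ] obj H)
  /-- conjugation `C_g` -/
  conj : ∀ (g : G) {H H' : Subgroup G}, H' = MulAut.conj g • H → (obj H →ₗ[ℚ] obj H')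
  res_self : ∀ {H : Subgroup G} (h : H ≤ H) (m : obj H), res h m = m
  ind_self : ∀ {H : Subgroup G} (h : H ≤ H) (m : obj H), ind h m = m
  conj_self : ∀ {H : Subgroup G} (g : G) (_ : g ∈ H) (e : H = MulAut.conj g • H) (m : obj H),
    conj g e m = m
  ind_trans : ∀ {L K H : Subgroup G} (hLK : L ≤ K) (hKH : K ≤ H) (hLH : L ≤ H) (m : obj L),
    ind hLH m = ind hKH (ind hLK m)
  res_trans : ∀ {L K H : Subgroup G} (hLK : L ≤ K) (hKH : K ≤ H) (hLH : L ≤ H) (m : obj H),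
    res hLH m = res hLK (res hKH m)
  conj_mul : ∀ (g h : G) {H H' H'' : Subgroup G} (e : H' = MulAut.conj h • H)
    (e' : H'' = MulAut.conj g • H') (e'' : H'' = MulAut.conj (g * h) • H) (m : obj H),
    conj (g * h) e'' m = conj g e' (conj h e m)
  res_conj : ∀ (g : G) {K H K' H' : Subgroup G} (hKH : K ≤ H) (hKH' : K' ≤ H')
    (eK : K' = MulAut.conj g • K) (eH : H' = MulAut.conj g • H) (m : obj H),
    res hKH' (conj g eH m) = conj g eK (res hKH m)
  ind_conj : ∀ (g : G) {K H K' H' : Subgroup G} (hKH : K ≤ H) (hKH' : K' ≤ H')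
    (eK : K' = MulAut.conj g • K) (eH : H' = MulAut.conj g • H) (m : obj K),
    ind hKH' (conj g eK m) = conj g eH (ind hKH m)
  /-- The Mackey axiom: for `K, L ≤ H` and every system `σ` of representatives of `K \ H / L`,
  `R^H_K ∘ I^H_L = ∑ x, I^K_{K ∩ x L x⁻¹} ∘ C_x ∘ R^L_{L ∩ x⁻¹ K x}`.
  (The sum is finite because `G` is.) -/
  mackey : ∀ {K L H : Subgroup G} (hK : K ≤ H) (hL : L ≤ H)
    (σ : DoubleCoset.Quotient (K.subgroupOf H : Set H) (L.subgroupOf H : Set H) → H)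
    (_ : ∀ q, DoubleCoset.mk (K.subgroupOf H) (L.subgroupOf H) (σ q) = q) (m : obj L),
    res hK (ind hL m) =
      ∑ᶠ q, ind (inf_le_left : K ⊓ MulAut.conj (σ q : G) • L ≤ K)
        (conj (σ q : G) (inf_conj_smul_eq K L (σ q : G))
          (res (inf_le_left : L ⊓ MulAut.conj (σ q : G)⁻¹ • K ≤ L) m))

namespace RationalMackeyFunctor

attribute [instance] RationalMackeyFunctor.addCommGroup RationalMackeyFunctor.module

variable {G : Type u} [Group G] [Finite G]

/-- A morphism of rational Mackey functors: a family of `ℚ`-linear maps commuting with all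
restriction, induction and conjugation maps. -/
@[ext]
structure Hom (M N : RationalMackeyFunctor.{u, v} G) where
  app : ∀ H : Subgroup G, M.obj H →ₗ[ℚ] N.obj H
  app_res : ∀ {K H : Subgroup G} (h : K ≤ H) (m : M.obj H),
    app K (M.res h m) = N.res h (app H m)
  app_ind : ∀ {K H : Subgroup G} (h : K ≤ H) (m : M.obj K),
    app H (M.ind h m) = N.ind h (app K m)
  app_conj : ∀ (g : G) {H H' : Subgroup G} (e : H' = MulAut.conj g • H) (m : M.obj H),
    app H' (M.conj g e m) = N.conj g e (app H m)

/-- The category of rational `G`-Mackey functors. -/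
instance category : Category (RationalMackeyFunctor.{u, v} G) where
  Hom M N := Hom M N
  id M :=
    { app := fun _ => LinearMap.id
      app_res := fun _ _ => rfl
      app_ind := fun _ _ => rfl
      app_conj := fun _ _ _ _ _ => rfl }
  comp f g :=
    { app := fun H => (g.app H).comp (f.app H)
      app_res := fun h m => by simp [f.app_res, g.app_res]
      app_ind := fun h m => by simp [f.app_ind, g.app_ind]
      app_conj := fun a _ _ e m => by simp [f.app_conj, g.app_conj] }

end RationalMackeyFunctor

/-! The category is von Neumann regular: every morphism f has some s with f s f = f
(`exists_pseudoInverse`). Hence every epimorphism and every monomorphism splits, which makes every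
object projective and injective. To build s, call a family of linear maps u_K good if it is
equivariant and vanishes before proper restrictions and after proper inductions. By the double coset
formula the weighted sum over K ≤ H of (|K|/|H|) I^H_K u_K R^H_K is then a morphism of Mackey
functors (`transferHom`). The family e_K = `primitive` is natural, idempotent and good, and its
transfer is the identity (`transfer_primitive`). Choose linear pseudo-inverses of the components of
f, average them over G to an equivariant family t, and let s be the transfer of the good family e t
e. As f commutes with e, one has f e t e f = e f t f e = f e, and taking transfers gives f s f = f.
-/

namespace RationalMackeyFunctor

noncomputable section

variable {G : Type u} [Group G] [Finite G]

/-- The lattice of subgroups of a finite group is finite. -/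
instance subgroupFintype : Fintype (Subgroup G) := Fintype.ofFinite _

/-! ### Double coset counts and sums over conjugate subgroups. -/

section Counting

variable {V : Type*} [AddCommGroup V] [Module ℚ V]

/-- Summation of a bi-invariant function over representatives of double cosets, if all double
cosets in its support have `n` elements. -/
theorem sum_doubleCoset_representatives {A : Type*} [Group A] [Fintype A] (L K : Subgroup A)
    (σ : DoubleCoset.Quotient (L : Set A) (K : Set A) → A)
    (hσ : ∀ q, DoubleCoset.mk L K (σ q) = q) (g : A → V) (n : ℕ)
    (hg : ∀ x, ∀ l ∈ L, ∀ k ∈ K, g (l * x * k) = g x)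
    (hn : ∀ x, g x ≠ 0 → Nat.card (DoubleCoset.doubleCoset x (L : Set A) K) = n) :
    (n : ℚ) • ∑ᶠ q, g (σ q) = ∑ x, g x := by
  classical
  have : Finite (DoubleCoset.Quotient (L : Set A) (K : Set A)) := Quotient.finite _
  let _ := Fintype.ofFinite (DoubleCoset.Quotient (L : Set A) (K : Set A))
  rw [finsum_eq_sum_of_fintype, Finset.smul_sum,
    ← Finset.sum_fiberwise Finset.univ (fun x => DoubleCoset.mk L K x)]
  refine Finset.sum_congr rfl fun q _ => ?_
  have hmem : ∀ x, DoubleCoset.mk L K x = q ↔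
      x ∈ DoubleCoset.doubleCoset (σ q) (L : Set A) K := fun x => by
    rw [← hσ q, hσ q, DoubleCoset.mem_doubleCoset]
    conv_lhs => rw [← hσ q]
    rw [eq_comm, DoubleCoset.eq]
    rfl
  have hconst : ∀ x ∈ Finset.univ.filter (fun x => DoubleCoset.mk L K x = q),
      g x = g (σ q) := fun x hx => by
    obtain ⟨l, hl, k, hk, rfl⟩ :=
      DoubleCoset.mem_doubleCoset.1 ((hmem x).1 (Finset.mem_filter.1 hx).2)
    exact hg _ l hl k hk
  rw [Finset.sum_congr rfl hconst, Finset.sum_const]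
  -- A double coset outside the support contributes zero whatever its size, so only sizes on the
  -- support matter.
  by_cases h0 : g (σ q) = 0
  · simp [h0]
  · rw [← hn _ h0, ← Nat.cast_smul_eq_nsmul ℚ]
    congr 2
    rw [Nat.card_eq_fintype_card, Fintype.card_subtype]
    congr 1
    ext x
    simp [hmem]

/-- If `x K x⁻¹ ≤ L` then `L x K = L x`. -/
theorem card_doubleCoset_left {A : Type*} [Group A] (L K : Subgroup A) (x : A)
    (h : ∀ k ∈ K, x * k * x⁻¹ ∈ L) :
    Nat.card (DoubleCoset.doubleCoset x (L : Set A) K) = Nat.card L := by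
  refine (Nat.card_congr (Equiv.ofBijective
    (fun l : L => (⟨l * x, DoubleCoset.mem_doubleCoset.2
      ⟨l, l.2, 1, K.one_mem, by simp⟩⟩ : DoubleCoset.doubleCoset x (L : Set A) K)) ⟨?_, ?_⟩)).symm
  · intro a b hab
    simpa using hab
  · rintro ⟨y, hy⟩
    obtain ⟨l, hl, k, hk, rfl⟩ := DoubleCoset.mem_doubleCoset.1 hy
    exact ⟨⟨l * (x * k * x⁻¹), L.mul_mem hl (h k hk)⟩, by simp [mul_assoc]⟩

/-- If `x⁻¹ K x ≤ L` then `K x L = x L`. -/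
theorem card_doubleCoset_right {A : Type*} [Group A] (K L : Subgroup A) (x : A)
    (h : ∀ k ∈ K, x⁻¹ * k * x ∈ L) :
    Nat.card (DoubleCoset.doubleCoset x (K : Set A) L) = Nat.card L := by
  refine (Nat.card_congr (Equiv.ofBijective
    (fun l : L => (⟨x * l, DoubleCoset.mem_doubleCoset.2
      ⟨1, K.one_mem, l, l.2, by simp⟩⟩ : DoubleCoset.doubleCoset x (K : Set A) L)) ⟨?_, ?_⟩)).symm
  · intro a b hab
    simpa using hab
  · rintro ⟨y, hy⟩
    obtain ⟨k, hk, l, hl, rfl⟩ := DoubleCoset.mem_doubleCoset.1 hy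
    exact ⟨⟨x⁻¹ * k * x * l, L.mul_mem (h k hk) hl⟩, by simp [mul_assoc]⟩

theorem card_conj_smul {G : Type*} [Group G] (g : G) (K : Subgroup G) :
    Nat.card (MulAut.conj g • K : Subgroup G) = Nat.card K :=
  (Nat.card_congr (Subgroup.equivSMul (MulAut.conj g) K).toEquiv).symm

theorem conj_smul_eq_self {G : Type*} [Group G] {g : G} {H : Subgroup G} (hg : g ∈ H) : MulAut.conj g • H = H :=
  Subgroup.conj_smul_eq_self_of_mem hg

theorem conj_smul_le_iff {G : Type*} [Group G] {g : G} {K H : Subgroup G} (hg : g ∈ H) :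
    MulAut.conj g • K ≤ H ↔ K ≤ H := by
  conv_lhs => rw [← conj_smul_eq_self hg]
  exact Subgroup.pointwise_smul_le_pointwise_smul_iff

theorem conj_smul_le_iff_forall {G : Type*} [Group G] {g : G} {K L : Subgroup G} :
    MulAut.conj g • K ≤ L ↔ ∀ k ∈ K, g * k * g⁻¹ ∈ L := by
  rw [Subgroup.pointwise_smul_subset_iff]
  refine ⟨fun h k hk => ?_, fun h k hk => ?_⟩
  · have := h hk
    rw [Subgroup.mem_inv_pointwise_smul_iff] at this
    simpa using this
  · rw [Subgroup.mem_inv_pointwise_smul_iff]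
    simpa using h k hk

/-- Conjugation permutes the subgroups and preserves their orders, so each x contributes the same
sum. With S = H and a = |L| this turns the weights |K|/|H| into |K|/|L|. -/
theorem sum_card_smul_conj (a : ℚ) (S : Type*) [Fintype S] [Nonempty S] (φ : S → G)
    (f : Subgroup G → V) :
    ∑ K : Subgroup G, ((Nat.card K : ℚ) / Nat.card S) •
        (a⁻¹ • ∑ x : S, f (MulAut.conj (φ x) • K)) =
      ∑ K : Subgroup G, ((Nat.card K : ℚ) / a) • f K := by
  have hS : (Nat.card S : ℚ) ≠ 0 := by
    rw [Nat.card_eq_fintype_card]; exact_mod_cast Fintype.card_ne_zero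
  have key : ∀ x : S, ∑ K : Subgroup G, (Nat.card K : ℚ) • f (MulAut.conj (φ x) • K) =
      ∑ K : Subgroup G, (Nat.card K : ℚ) • f K := fun x => by
    rw [← Equiv.sum_comp (MulAction.toPerm (MulAut.conj (φ x)) : Equiv.Perm (Subgroup G))
      fun K => (Nat.card K : ℚ) • f K]
    simp [card_conj_smul]
  have : ∀ K : Subgroup G, ((Nat.card K : ℚ) / Nat.card S) •
        (a⁻¹ • ∑ x : S, f (MulAut.conj (φ x) • K)) =
      ((Nat.card S : ℚ)⁻¹ * a⁻¹) • ∑ x : S, (Nat.card K : ℚ) • f (MulAut.conj (φ x) • K) :=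
    fun K => by
      rw [← Finset.smul_sum, smul_smul, smul_smul]
      congr 1
      ring
  simp_rw [this]
  rw [← Finset.smul_sum, Finset.sum_comm]
  simp_rw [key]
  rw [Finset.sum_const, Finset.card_univ, ← Nat.cast_smul_eq_nsmul ℚ, smul_smul,
    ← Nat.card_eq_fintype_card, Finset.smul_sum]
  refine Finset.sum_congr rfl fun K _ => ?_
  rw [smul_smul]
  congr 1
  field_simp

end Counting

/-! ### Morphisms built from families on primitive parts. -/

section Transfer

variable {X E : RationalMackeyFunctor.{u, v} G} (u : ∀ K, X.obj K →ₗ[ℚ] E.obj K)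

open Classical in
/-- `I^H_K ∘ u_K ∘ R^H_K` if `K ≤ H`, and `0` otherwise. -/
def transferTerm (H K : Subgroup G) : X.obj H →ₗ[ℚ] E.obj H :=
  if h : K ≤ H then E.ind h ∘ₗ u K ∘ₗ X.res h else 0

/-- `∑_{K ≤ H} |K| / |H| • I^H_K ∘ u_K ∘ R^H_K`. -/
def transfer (H : Subgroup G) : X.obj H →ₗ[ℚ] E.obj H :=
  ∑ K : Subgroup G, ((Nat.card K : ℚ) / Nat.card H) • transferTerm u H K

variable {u}

theorem transferTerm_of_le {H K : Subgroup G} (h : K ≤ H) (m : X.obj H) :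
    transferTerm u H K m = E.ind h (u K (X.res h m)) := by
  simp [transferTerm, h]

theorem transferTerm_of_not_le {H K : Subgroup G} (h : ¬ K ≤ H) (m : X.obj H) :
    transferTerm u H K m = 0 := by
  simp [transferTerm, h]

theorem transfer_apply (H : Subgroup G) (m : X.obj H) :
    transfer u H m = ∑ K : Subgroup G, ((Nat.card K : ℚ) / Nat.card H) • transferTerm u H K m := by
  simp [transfer]

theorem conj_transferTerm {u' : ∀ K, X.obj K →ₗ[ℚ] E.obj K} {g : G} {K H K' H' : Subgroup G}
    (eK : K' = MulAut.conj g • K) (eH : H' = MulAut.conj g • H)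
    (hu : K ≤ H → ∀ m, E.conj g eK (u K m) = u' K' (X.conj g eK m)) (m : X.obj H) :
    E.conj g eH (transferTerm u H K m) = transferTerm u' H' K' (X.conj g eH m) := by
  by_cases h : K ≤ H
  · have h' : K' ≤ H' := by
      rw [eK, eH]; exact Subgroup.pointwise_smul_le_pointwise_smul_iff.2 h
    rw [transferTerm_of_le h, transferTerm_of_le h', X.res_conj g h h' eK eH, ← hu h,
      E.ind_conj g h h' eK eH]
  · have h' : ¬ K' ≤ H' := by
      rw [eK, eH]; exact fun h' => h (Subgroup.pointwise_smul_le_pointwise_smul_iff.1 h')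
    rw [transferTerm_of_not_le h, transferTerm_of_not_le h', map_zero]

/-- Conjugation by elements of `H` permutes the summands of the transfer at `H`. -/
theorem transferTerm_conj_smul {g : G} {K H : Subgroup G} (hg : g ∈ H)
    (hu : K ≤ H → ∀ m, E.conj g rfl (u K m) = u (MulAut.conj g • K) (X.conj g rfl m))
    (m : X.obj H) :
    transferTerm u H (MulAut.conj g • K) m = transferTerm u H K m := by
  have eH : H = MulAut.conj g • H := (conj_smul_eq_self hg).symm
  rw [← E.conj_self g hg eH (transferTerm u H K m), conj_transferTerm rfl eH hu,
    X.conj_self g hg]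

theorem conj_transfer {u' : ∀ K, X.obj K →ₗ[ℚ] E.obj K} {g : G} {H H' : Subgroup G}
    (eH : H' = MulAut.conj g • H)
    (hu : ∀ K ≤ H, ∀ K' (e : K' = MulAut.conj g • K) m,
      E.conj g e (u K m) = u' K' (X.conj g e m)) (m : X.obj H) :
    E.conj g eH (transfer u H m) = transfer u' H' (X.conj g eH m) := by
  rw [transfer_apply, transfer_apply, map_sum,
    ← Equiv.sum_comp (MulAction.toPerm (MulAut.conj g) : Equiv.Perm (Subgroup G))
      fun K => ((Nat.card K : ℚ) / Nat.card H') • transferTerm u' H' K (X.conj g eH m)]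
  refine Finset.sum_congr rfl fun K _ => ?_
  have hH : Nat.card H' = Nat.card H := by rw [eH, card_conj_smul]
  rw [map_smul, conj_transferTerm (K' := MulAut.conj g • K) rfl eH fun h => hu K h _ rfl,
    MulAction.toPerm_apply, card_conj_smul, hH]

/-- The general summand of the Mackey formula, if the subgroups in it are all of `K` and of
`x K x⁻¹`. -/
theorem ind_conj_res_of_eq {x : G} {J J' K K' L : Subgroup G} (hJ : J = K) (hJ' : J' = K')
    (hJK : J ≤ K) (e : J' = MulAut.conj x • J) (eK : K' = MulAut.conj x • K) (hJL : J' ≤ L)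
    (hKL : K' ≤ L) (m : E.obj K) :
    E.ind hJL (E.conj x e (E.res hJK m)) = E.ind hKL (E.conj x eK m) := by
  subst hJ hJ'
  rw [E.res_self]

/-- The dual of `ind_conj_res_of_eq`. -/
theorem ind_conj_res_of_eq' {x : G} {J J' K K' L : Subgroup G} (hJ : J = K) (hJ' : J' = K')
    (hJL : J ≤ L) (hKL : K ≤ L) (e : J' = MulAut.conj x • J) (eK : K' = MulAut.conj x • K)
    (hJK : J' ≤ K') (m : E.obj L) :
    E.ind hJK (E.conj x e (E.res hJL m)) = E.conj x eK (E.res hKL m) := by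
  subst hJ hJ'
  rw [E.ind_self]

/-- In the Mackey formula the x-summand vanishes unless x K x⁻¹ ≤ L, since otherwise u_K is followed
by a proper restriction. In the remaining case it is the term of x K x⁻¹, and L x K = L x has |L|
elements, whence the factor 1/|L|. -/
theorem res_transferTerm {L H : Subgroup G} (hL : L ≤ H)
    (hconj : ∀ K ≤ H, ∀ g ∈ H, ∀ K' (e : K' = MulAut.conj g • K) m,
      E.conj g e (u K m) = u K' (X.conj g e m))
    (hres : ∀ K ≤ H, ∀ J (h : J < K) m, E.res h.le (u K m) = 0)
    (K : Subgroup G) (m : X.obj H) :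
    letI := Fintype.ofFinite H
    E.res hL (transferTerm u H K m) =
      (Nat.card L : ℚ)⁻¹ • ∑ x : H, transferTerm u L (MulAut.conj (x : G) • K) (X.res hL m) := by
  let _ := Fintype.ofFinite H
  by_cases hK : K ≤ H
  swap
  · rw [transferTerm_of_not_le hK, map_zero, Finset.sum_eq_zero, smul_zero]
    intro x _
    exact transferTerm_of_not_le (fun h => hK ((conj_smul_le_iff x.2).1 (h.trans hL))) _
  let σ : DoubleCoset.Quotient (L.subgroupOf H : Set H) (K.subgroupOf H : Set H) → H := Quotient.out
  have hσ : ∀ q, DoubleCoset.mk (L.subgroupOf H) (K.subgroupOf H) (σ q) = q := Quotient.out_eq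
  have hLcard : (Nat.card L : ℚ) ≠ 0 := by exact_mod_cast Nat.card_pos.ne'
  rw [eq_inv_smul_iff₀ hLcard, transferTerm_of_le hK, E.mackey hL hK σ hσ,
    ← sum_doubleCoset_representatives (L.subgroupOf H) (K.subgroupOf H) σ hσ
      (fun x : H => transferTerm u L (MulAut.conj (x : G) • K) (X.res hL m)) (Nat.card L)]
  · congr 1
    refine finsum_congr fun q => ?_
    generalize σ q = x
    by_cases hx : MulAut.conj (x : G) • K ≤ L
    · have hx' : K ≤ MulAut.conj (x : G)⁻¹ • L := by
        rw [map_inv]; exact Subgroup.pointwise_smul_subset_iff.1 hx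
      have e : H = MulAut.conj (x : G) • H := (conj_smul_eq_self x.2).symm
      rw [ind_conj_res_of_eq (inf_eq_left.2 hx') (inf_eq_right.2 hx) inf_le_left _ rfl _ hx,
        transferTerm_of_le hx, hconj K hK x x.2, ← X.res_trans hx hL (hx.trans hL),
        ← X.res_conj x hK (hx.trans hL) rfl e, X.conj_self x x.2 e]
    · have hlt : K ⊓ MulAut.conj (x : G)⁻¹ • L < K := by
        refine inf_le_left.lt_of_ne fun h => hx ?_
        rw [Subgroup.pointwise_smul_subset_iff, ← map_inv]
        exact inf_eq_left.1 h
      rw [transferTerm_of_not_le hx, hres K hK _ hlt, map_zero, map_zero]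
  · intro x l hl k hk
    have hk' : MulAut.conj (k : G) • K = K := conj_smul_eq_self hk
    rw [Subgroup.coe_mul, Subgroup.coe_mul, map_mul, map_mul, mul_smul, mul_smul, hk']
    refine transferTerm_conj_smul (Subgroup.mem_subgroupOf.1 hl) (fun h => ?_) _
    exact hconj _ (h.trans hL) _ l.2 _ rfl
  · intro x hx
    have hx' : MulAut.conj (x : G) • K ≤ L := by
      by_contra h
      exact hx (transferTerm_of_not_le h _)
    rw [card_doubleCoset_left, Nat.card_congr (Subgroup.subgroupOfEquivOfLe hL).toEquiv]
    exact fun k hk => conj_smul_le_iff_forall.1 hx' _ hk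

/-- Dual argument: x⁻¹ K x ≤ L is needed for a nonzero summand, and then K x L = x L. -/
theorem transferTerm_ind {L H : Subgroup G} (hL : L ≤ H)
    (hconj : ∀ K ≤ H, ∀ g ∈ H, ∀ K' (e : K' = MulAut.conj g • K) m,
      E.conj g e (u K m) = u K' (X.conj g e m))
    (hind : ∀ K ≤ H, ∀ J (h : J < K) m, u K (X.ind h.le m) = 0)
    (K : Subgroup G) (m : X.obj L) :
    letI := Fintype.ofFinite H
    transferTerm u H K (X.ind hL m) =
      (Nat.card L : ℚ)⁻¹ •
        ∑ x : H, E.ind hL (transferTerm u L (MulAut.conj (x : G)⁻¹ • K) m) := by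
  let _ := Fintype.ofFinite H
  by_cases hK : K ≤ H
  swap
  · rw [transferTerm_of_not_le hK, Finset.sum_eq_zero, smul_zero]
    intro x _
    rw [transferTerm_of_not_le, map_zero]
    exact fun h => hK ((conj_smul_le_iff (H.inv_mem x.2)).1 (h.trans hL))
  let σ : DoubleCoset.Quotient (K.subgroupOf H : Set H) (L.subgroupOf H : Set H) → H := Quotient.out
  have hσ : ∀ q, DoubleCoset.mk (K.subgroupOf H) (L.subgroupOf H) (σ q) = q := Quotient.out_eq
  have : Finite (DoubleCoset.Quotient (K.subgroupOf H : Set H) (L.subgroupOf H : Set H)) :=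
    Quotient.finite _
  have hLcard : (Nat.card L : ℚ) ≠ 0 := by exact_mod_cast Nat.card_pos.ne'
  rw [eq_inv_smul_iff₀ hLcard, transferTerm_of_le hK, X.mackey hK hL σ hσ,
    ← sum_doubleCoset_representatives (K.subgroupOf H) (L.subgroupOf H) σ hσ
      (fun x : H => E.ind hL (transferTerm u L (MulAut.conj (x : G)⁻¹ • K) m)) (Nat.card L),
    ← LinearMap.comp_apply, map_finsum _ (Set.toFinite _)]
  · congr 1
    refine finsum_congr fun q => ?_
    generalize σ q = x
    rw [LinearMap.comp_apply]
    by_cases hx : MulAut.conj (x : G)⁻¹ • K ≤ L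
    · have hx' : K ≤ MulAut.conj (x : G) • L := by
        rw [map_inv] at hx; simpa using Subgroup.pointwise_smul_subset_iff.1 hx
      have e : H = MulAut.conj (x : G) • H := (conj_smul_eq_self x.2).symm
      have eK : K = MulAut.conj (x : G) • MulAut.conj (x : G)⁻¹ • K := by
        rw [smul_smul, ← map_mul, mul_inv_cancel, map_one, one_smul]
      rw [ind_conj_res_of_eq' (inf_eq_right.2 hx) (inf_eq_left.2 hx') inf_le_left hx _ eK,
        transferTerm_of_le hx, ← E.ind_trans hx hL (hx.trans hL),
        ← hconj _ (hx.trans hL) x x.2, E.ind_conj x (hx.trans hL) hK eK e, E.conj_self x x.2 e]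
    · have hlt : K ⊓ MulAut.conj (x : G) • L < K := by
        refine inf_le_left.lt_of_ne fun h => hx ?_
        rw [Subgroup.pointwise_smul_subset_iff, ← map_inv, inv_inv]
        exact inf_eq_left.1 h
      rw [transferTerm_of_not_le hx, hind K hK _ hlt, map_zero, map_zero]
  · intro x k hk l hl
    have hk' : MulAut.conj (k : G)⁻¹ • K = K := conj_smul_eq_self (K.inv_mem hk)
    rw [Subgroup.coe_mul, Subgroup.coe_mul, mul_inv_rev, mul_inv_rev, map_mul, map_mul, mul_smul,
      mul_smul, hk']
    refine congrArg _ (transferTerm_conj_smul (L.inv_mem (Subgroup.mem_subgroupOf.1 hl)) (fun h => ?_) _)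
    exact hconj _ (h.trans hL) _ (H.inv_mem l.2) _ rfl
  · intro x hx
    have hx' : MulAut.conj (x : G)⁻¹ • K ≤ L := by
      by_contra h
      exact hx (by rw [transferTerm_of_not_le h, map_zero])
    rw [card_doubleCoset_right, Nat.card_congr (Subgroup.subgroupOfEquivOfLe hL).toEquiv]
    intro k hk
    simpa [Subgroup.mem_subgroupOf] using conj_smul_le_iff_forall.1 hx' _ hk

/-- The hypotheses concern only subgroups and elements of H, so that the lemma applies to the
truncated family `properPrimitive`. -/
theorem res_transfer {L H : Subgroup G} (hL : L ≤ H)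
    (hconj : ∀ K ≤ H, ∀ g ∈ H, ∀ K' (e : K' = MulAut.conj g • K) m,
      E.conj g e (u K m) = u K' (X.conj g e m))
    (hres : ∀ K ≤ H, ∀ J (h : J < K) m, E.res h.le (u K m) = 0) (m : X.obj H) :
    E.res hL (transfer u H m) = transfer u L (X.res hL m) := by
  let _ := Fintype.ofFinite H
  rw [transfer_apply, transfer_apply, map_sum]
  simp_rw [map_smul, res_transferTerm hL hconj hres]
  exact sum_card_smul_conj (Nat.card L : ℚ) H (fun x => (x : G))
    fun K => transferTerm u L K (X.res hL m)

theorem transfer_ind {L H : Subgroup G} (hL : L ≤ H)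
    (hconj : ∀ K ≤ H, ∀ g ∈ H, ∀ K' (e : K' = MulAut.conj g • K) m,
      E.conj g e (u K m) = u K' (X.conj g e m))
    (hind : ∀ K ≤ H, ∀ J (h : J < K) m, u K (X.ind h.le m) = 0) (m : X.obj L) :
    transfer u H (X.ind hL m) = E.ind hL (transfer u L m) := by
  let _ := Fintype.ofFinite H
  rw [transfer_apply, transfer_apply, map_sum]
  simp_rw [map_smul, transferTerm_ind hL hconj hind]
  exact sum_card_smul_conj (Nat.card L : ℚ) H (fun x => (x : G)⁻¹)
    fun K => E.ind hL (transferTerm u L K m)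

variable (u) in
/-- An equivariant family of maps killed by proper restrictions and inductions induces a morphism
of Mackey functors. -/
def transferHom
    (hconj : ∀ (g : G) K K' (e : K' = MulAut.conj g • K) m,
      E.conj g e (u K m) = u K' (X.conj g e m))
    (hres : ∀ K J (h : J < K) m, E.res h.le (u K m) = 0)
    (hind : ∀ K J (h : J < K) m, u K (X.ind h.le m) = 0) : Hom X E where
  app := transfer u
  app_res h m := (res_transfer h (fun K _ g _ => hconj g K) (fun K _ => hres K) m).symm
  app_ind h m := transfer_ind h (fun K _ g _ => hconj g K) (fun K _ => hind K) m
  app_conj g _ _ e m := (conj_transfer e (fun K _ => hconj g K) m).symm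

end Transfer

/-! ### The primitive idempotents. -/

section Primitive

variable (M : RationalMackeyFunctor.{u, v} G)

open Classical in
/-- The projection of `M(G/H)` onto the intersection of the kernels of the restrictions to proper
subgroups of `H`, along the sum of the images of the inductions from them. -/
def primitive (H : Subgroup G) : M.obj H →ₗ[ℚ] M.obj H :=
  LinearMap.id - ∑ K : Subgroup G, ((Nat.card K : ℚ) / Nat.card H) •
    if h : K < H then M.ind h.le ∘ₗ primitive K ∘ₗ M.res h.le else 0
termination_by Nat.card H
decreasing_by exact Set.ncard_lt_ncard (SetLike.coe_ssubset_coe.2 h) (Set.toFinite _)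

open Classical in
/-- The family of projections `primitive`, with the one at `H` replaced by `0`. -/
def properPrimitive (H K : Subgroup G) : M.obj K →ₗ[ℚ] M.obj K :=
  if K = H then 0 else M.primitive K

variable {M}

theorem properPrimitive_self (H : Subgroup G) : M.properPrimitive H H = 0 := by
  simp [properPrimitive]

theorem properPrimitive_of_ne {H K : Subgroup G} (h : K ≠ H) :
    M.properPrimitive H K = M.primitive K := by
  simp [properPrimitive, h]

/-- Replacing the map at H by zero turns the recursive sum into a transfer, so the transfer lemmas
apply. -/
theorem primitive_eq (H : Subgroup G) :
    M.primitive H = LinearMap.id - transfer (M.properPrimitive H) H := by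
  rw [primitive, transfer]
  congr 1
  refine Finset.sum_congr rfl fun K _ => ?_
  congr 1
  by_cases h : K < H
  · rw [dif_pos h, transferTerm, dif_pos h.le, properPrimitive_of_ne h.ne]
  · rw [dif_neg h, transferTerm]
    split_ifs with h'
    · obtain rfl : K = H := h'.eq_of_not_lt h
      simp [properPrimitive_self]
    · rfl

/-- The identity is the transfer of the family `primitive`. -/
theorem transfer_primitive (H : Subgroup G) : transfer M.primitive H = LinearMap.id := by
  have h : transfer M.primitive H = M.primitive H + transfer (M.properPrimitive H) H := by
    classical
    have hH : (Nat.card H : ℚ) ≠ 0 := by exact_mod_cast Nat.card_pos.ne'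
    rw [transfer, transfer, ← Finset.add_sum_erase _ _ (Finset.mem_univ H),
      ← Finset.add_sum_erase (a := H) Finset.univ (fun K : Subgroup G => ((Nat.card K : ℚ) / Nat.card H) •
        transferTerm (M.properPrimitive H) H K) (Finset.mem_univ H), div_self hH, one_smul, one_smul]
    have h1 : transferTerm M.primitive H H = M.primitive H := by
      ext m
      rw [transferTerm_of_le le_rfl, M.res_self, M.ind_self]
    have h2 : transferTerm (M.properPrimitive H) H H = 0 := by
      ext m
      rw [transferTerm_of_le le_rfl, properPrimitive_self]
      simp
    rw [h1, h2, zero_add]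
    congr 1
    refine Finset.sum_congr rfl fun K hK => ?_
    rw [transferTerm, transferTerm, properPrimitive_of_ne (Finset.ne_of_mem_erase hK)]
  rw [h, primitive_eq, sub_add_cancel]

theorem conj_primitive (H : Subgroup G) : ∀ (g : G) (H' : Subgroup G)
    (e : H' = MulAut.conj g • H) (m : M.obj H),
    M.conj g e (M.primitive H m) = M.primitive H' (M.conj g e m) := by
  induction H using WellFoundedLT.induction with
  | ind H ih =>
  intro g H' e m
  simp only [primitive_eq, LinearMap.sub_apply, LinearMap.id_apply, map_sub]
  rw [conj_transfer e (u' := M.properPrimitive H')]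
  intro K hK K' eK m
  by_cases h : K = H
  · have h' : K' = H' := by rw [eK, e, h]
    subst h h'
    simp [properPrimitive_self]
  · have h' : K' ≠ H' := fun h' => h (by rw [eK, e] at h'; exact smul_left_cancel _ h')
    rw [properPrimitive_of_ne h, properPrimitive_of_ne h', ih K (hK.lt_of_ne h)]

theorem conj_properPrimitive {H : Subgroup G} {g : G} (hg : g ∈ H) (K K' : Subgroup G)
    (e : K' = MulAut.conj g • K) (m : M.obj K) :
    M.conj g e (M.properPrimitive H K m) = M.properPrimitive H K' (M.conj g e m) := by
  by_cases h : K = H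
  · have h' : K' = H := by rw [e, h, conj_smul_eq_self hg]
    subst h
    subst h'
    simp [properPrimitive_self]
  · have h' : K' ≠ H := fun h' => h (by
      rw [e, ← conj_smul_eq_self hg] at h'; exact smul_left_cancel _ h')
    rw [properPrimitive_of_ne h, properPrimitive_of_ne h', conj_primitive]

theorem transfer_properPrimitive_of_lt {L H : Subgroup G} (h : L < H) :
    transfer (M.properPrimitive H) L = LinearMap.id := by
  rw [← transfer_primitive L, transfer, transfer]
  refine Finset.sum_congr rfl fun K _ => ?_
  congr 1
  rw [transferTerm, transferTerm]
  split_ifs with hK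
  · rw [properPrimitive_of_ne (hK.trans_lt h).ne]
  · rfl

/-- Restriction to L < H commutes with the transfer of `properPrimitive`, which is the identity at
L; the two terms of `primitive_eq` cancel. The vanishing needed for this holds by induction below H
and trivially at H. -/
theorem res_primitive (H : Subgroup G) :
    ∀ (L : Subgroup G) (h : L < H) (m : M.obj H), M.res h.le (M.primitive H m) = 0 := by
  induction H using WellFoundedLT.induction with
  | ind H ih =>
  intro L h m
  rw [primitive_eq, LinearMap.sub_apply, LinearMap.id_apply, map_sub,
    res_transfer h.le (fun K _ g hg => conj_properPrimitive hg K), transfer_properPrimitive_of_lt h,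
    LinearMap.id_apply, sub_self]
  intro K hK J hJ m
  by_cases hKH : K = H
  · subst hKH
    simp [properPrimitive_self]
  · rw [properPrimitive_of_ne hKH, ih K (hK.lt_of_ne hKH) J hJ]

theorem primitive_ind (H : Subgroup G) :
    ∀ (L : Subgroup G) (h : L < H) (m : M.obj L), M.primitive H (M.ind h.le m) = 0 := by
  induction H using WellFoundedLT.induction with
  | ind H ih =>
  intro L h m
  rw [primitive_eq, LinearMap.sub_apply, LinearMap.id_apply,
    transfer_ind h.le (fun K _ g hg => conj_properPrimitive hg K), transfer_properPrimitive_of_lt h,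
    LinearMap.id_apply, sub_self]
  intro K hK J hJ m
  by_cases hKH : K = H
  · subst hKH
    simp [properPrimitive_self]
  · rw [properPrimitive_of_ne hKH, ih K (hK.lt_of_ne hKH) J hJ]

/-- Every correction term starts with a proper restriction, which kills primitive elements. -/
theorem primitive_primitive (H : Subgroup G) (m : M.obj H) :
    M.primitive H (M.primitive H m) = M.primitive H m := by
  have h := LinearMap.congr_fun (primitive_eq (M := M) H) (M.primitive H m)
  rw [h, LinearMap.sub_apply, LinearMap.id_apply, sub_eq_self, transfer_apply, Finset.sum_eq_zero]
  intro K _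
  by_cases hK : K ≤ H
  · rcases hK.eq_or_lt with rfl | hlt
    · rw [transferTerm_of_le le_rfl, properPrimitive_self]
      simp
    · rw [transferTerm_of_le hK, res_primitive H K hlt]
      simp
  · rw [transferTerm_of_not_le hK, smul_zero]

variable {N : RationalMackeyFunctor.{u, v} G}

/-- Composition of a transfer with morphisms. -/
theorem app_transfer_app {X E : RationalMackeyFunctor.{u, v} G} (f : Hom E N) (f' : Hom M X)
    (u : ∀ K, X.obj K →ₗ[ℚ] E.obj K) (w : ∀ K, M.obj K →ₗ[ℚ] N.obj K) (H : Subgroup G)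
    (h : ∀ K ≤ H, ∀ m, f.app K (u K (f'.app K m)) = w K m) (m : M.obj H) :
    f.app H (transfer u H (f'.app H m)) = transfer w H m := by
  rw [transfer_apply, transfer_apply, map_sum]
  refine Finset.sum_congr rfl fun K _ => ?_
  rw [map_smul]
  congr 1
  by_cases hK : K ≤ H
  · rw [transferTerm_of_le hK, transferTerm_of_le hK, f.app_ind, ← f'.app_res, h K hK]
  · rw [transferTerm_of_not_le hK, transferTerm_of_not_le hK, map_zero]

theorem app_transfer {E : RationalMackeyFunctor.{u, v} G} (f : Hom E N)
    (u : ∀ K, M.obj K →ₗ[ℚ] E.obj K) (w : ∀ K, M.obj K →ₗ[ℚ] N.obj K) (H : Subgroup G)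
    (h : ∀ K ≤ H, ∀ m, f.app K (u K m) = w K m) (m : M.obj H) :
    f.app H (transfer u H m) = transfer w H m :=
  app_transfer_app f (𝟙 M : Hom M M) u w H h m

theorem transfer_app {X : RationalMackeyFunctor.{u, v} G} (f : Hom M X)
    (u : ∀ K, X.obj K →ₗ[ℚ] N.obj K) (w : ∀ K, M.obj K →ₗ[ℚ] N.obj K) (H : Subgroup G)
    (h : ∀ K ≤ H, ∀ m, u K (f.app K m) = w K m) (m : M.obj H) :
    transfer u H (f.app H m) = transfer w H m :=
  app_transfer_app (𝟙 N : Hom N N) f u w H h m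

theorem app_primitive (f : Hom M N) (H : Subgroup G) :
    ∀ m : M.obj H, f.app H (M.primitive H m) = N.primitive H (f.app H m) := by
  induction H using WellFoundedLT.induction with
  | ind H ih =>
  intro m
  have ih' : ∀ K ≤ H, ∀ m, f.app K (M.properPrimitive H K m) =
      N.properPrimitive H K (f.app K m) := fun K hK m => by
    by_cases hKH : K = H
    · subst hKH
      simp [properPrimitive_self]
    · rw [properPrimitive_of_ne hKH, properPrimitive_of_ne hKH, ih K (hK.lt_of_ne hKH)]
  rw [primitive_eq, primitive_eq, LinearMap.sub_apply, LinearMap.sub_apply, map_sub,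
    app_transfer f _ (fun K => (N.properPrimitive H K).comp (f.app K)) H ih',
    transfer_app f _ (fun K => (N.properPrimitive H K).comp (f.app K)) H fun _ _ _ => rfl]
  rfl

end Primitive

/-! ### Averaging over G. -/

section Average

variable {X E : RationalMackeyFunctor.{u, v} G} (s : ∀ K, X.obj K →ₗ[ℚ] E.obj K)

/-- The average of a family of linear maps over its conjugates. -/
def average (K : Subgroup G) : X.obj K →ₗ[ℚ] E.obj K :=
  letI := Fintype.ofFinite G
  (Nat.card G : ℚ)⁻¹ • ∑ g : G, E.conj g⁻¹ (by rw [smul_smul, ← map_mul]; simp) ∘ₗ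
    s (MulAut.conj g • K) ∘ₗ X.conj g rfl

variable {s}

theorem average_apply [Fintype G] (K : Subgroup G) (m : X.obj K) :
    average s K m = (Nat.card G : ℚ)⁻¹ • ∑ g : G,
      E.conj g⁻¹ (by rw [smul_smul, ← map_mul]; simp)
        (s (MulAut.conj g • K) (X.conj g rfl m)) := by
  simp only [average, LinearMap.smul_apply, LinearMap.sum_apply, LinearMap.comp_apply]
  congr!

theorem conj_average (g : G) (K K' : Subgroup G) (e : K' = MulAut.conj g • K) (m : X.obj K) :
    E.conj g e (average s K m) = average s K' (X.conj g e m) := by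
  let _ := Fintype.ofFinite G
  rw [average_apply, average_apply, map_smul, map_sum, ← Equiv.sum_comp (Equiv.mulRight g)]
  congr 1
  refine Finset.sum_congr rfl fun x _ => ?_
  -- The subgroup y K y⁻¹ is kept as a variable L, so that substitution identifies it with x K' x⁻¹
  -- without casts.
  have aux : ∀ (y : G) (L : Subgroup G) (hy : y = x * g) (hL : L = MulAut.conj x • K')
      (e1 : K = MulAut.conj y⁻¹ • L) (e2 : L = MulAut.conj y • K),
      E.conj g e (E.conj y⁻¹ e1 (s L (X.conj y e2 m))) =
        E.conj x⁻¹ (by rw [smul_smul, ← map_mul]; simp)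
          (s (MulAut.conj x • K') (X.conj x rfl (X.conj g e m))) := by
    rintro y L rfl rfl e1 e2
    have h : g * (x * g)⁻¹ = x⁻¹ := by group
    rw [← E.conj_mul _ _ e1 e (by rw [h, smul_smul, ← map_mul]; simp), X.conj_mul x g e rfl e2]
    congr!
  exact aux _ _ rfl (by rw [e, smul_smul, ← map_mul]; rfl) _ _

/-- Averaging preserves pseudo-inverses of a morphism. -/
theorem app_average_app (f : Hom E X)
    (hs : ∀ K m, f.app K (s K (f.app K m)) = f.app K m) (K : Subgroup G) (m : E.obj K) :
    f.app K (average s K (f.app K m)) = f.app K m := by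
  let _ := Fintype.ofFinite G
  have hG : (Nat.card G : ℚ) ≠ 0 := by exact_mod_cast Nat.card_pos.ne'
  rw [average_apply, map_smul, map_sum, inv_smul_eq_iff₀ hG]
  rw [Finset.sum_congr rfl (g := fun _ => f.app K m), Finset.sum_const, Finset.card_univ,
    ← Nat.card_eq_fintype_card, Nat.cast_smul_eq_nsmul]
  intro g _
  rw [f.app_conj, ← f.app_conj g, hs, f.app_conj,
    ← X.conj_mul g⁻¹ g rfl _ (by simp)]
  have aux : ∀ (y : G) (hy : y = 1) (e : K = MulAut.conj y • K), X.conj y e (f.app K m) =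
      f.app K m := by
    rintro y rfl e
    exact X.conj_self 1 K.one_mem e _
  exact aux _ (by simp) _

end Average

/-! ### Von Neumann regularity and splitting. -/

theorem exists_linear_pseudoInverse {V W : Type*} [AddCommGroup V] [Module ℚ V] [AddCommGroup W]
    [Module ℚ W] (f : V →ₗ[ℚ] W) : ∃ s : W →ₗ[ℚ] V, ∀ m, f (s (f m)) = f m := by
  -- A section over the range of f, extended to all of W.
  obtain ⟨t, ht⟩ := f.rangeRestrict.exists_rightInverse_of_surjective f.range_rangeRestrict
  obtain ⟨s, hs⟩ := LinearMap.exists_extend t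
  refine ⟨s, fun m => ?_⟩
  have h1 : s (f m) = t (f.rangeRestrict m) := LinearMap.congr_fun hs (f.rangeRestrict m)
  have h2 : f.rangeRestrict (t (f.rangeRestrict m)) = f.rangeRestrict m :=
    LinearMap.congr_fun ht _
  rw [h1]
  exact congrArg Subtype.val h2

/-- The category of rational Mackey functors is von Neumann regular. -/
theorem exists_pseudoInverse {E X : RationalMackeyFunctor.{u, v} G} (f : E ⟶ X) :
    ∃ s : X ⟶ E, f ≫ s ≫ f = f := by
  change Hom E X at f
  choose s hs using fun K => exists_linear_pseudoInverse (f.app K)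
  let w : ∀ K, X.obj K →ₗ[ℚ] E.obj K :=
    fun K => E.primitive K ∘ₗ average s K ∘ₗ X.primitive K
  refine ⟨transferHom w ?_ ?_ ?_, ?_⟩
  · intro g K K' e m
    simp only [w, LinearMap.comp_apply]
    rw [conj_primitive, conj_average, conj_primitive]
  · exact fun K J h m => res_primitive K J h _
  · intro K J h m
    simp only [w, LinearMap.comp_apply]
    rw [primitive_ind K J h, map_zero, map_zero]
  · refine Hom.ext (funext fun H => LinearMap.ext fun m => ?_)
    change f.app H (transfer w H (f.app H m)) = f.app H m
    -- Both f s f and f are transfers of the family f e.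
    rw [app_transfer_app f f w (fun K => (f.app K).comp (E.primitive K)) H,
      ← app_transfer f E.primitive (fun K => (f.app K).comp (E.primitive K)) H fun _ _ _ => rfl,
      transfer_primitive, LinearMap.id_apply]
    intro K _ m
    simp only [w, LinearMap.comp_apply]
    rw [app_primitive f, ← app_primitive f K m, app_average_app f hs, app_primitive f,
      primitive_primitive, ← app_primitive f]

end

end RationalMackeyFunctor

open RationalMackeyFunctor in
theorem mainTheorem5 {G : Type u} [Group G] [Finite G] (M : RationalMackeyFunctor.{u, v} G) :
    CategoryTheory.Projective M ∧ CategoryTheory.Injective M := by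
  refine ⟨⟨fun {E X} f e he => ?_⟩, ⟨fun {X Y} g i hi => ?_⟩⟩
  · obtain ⟨s, hs⟩ := exists_pseudoInverse e
    have h : s ≫ e = 𝟙 X := by rw [← cancel_epi e, hs, Category.comp_id]
    exact ⟨f ≫ s, by rw [Category.assoc, h, Category.comp_id]⟩
  · obtain ⟨s, hs⟩ := exists_pseudoInverse i
    have h : i ≫ s = 𝟙 X := by rw [← cancel_mono i, Category.assoc, hs, Category.id_comp]
    exact ⟨s ≫ g, by rw [← Category.assoc, h, Category.id_comp]⟩
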